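/- Let $n\ge 1$, $d=2^n$, and $\mathbb{O}(d)=\{U\in\mathbb{U}(d): U^{\mathsf T}U=\mathbb{1}\}$, acting on $n$ qubits arranged on an open line. A depth-$L$ circuit is a product of $L$ layers. Each layer is a product of gates from $\mathbb{O}(d)$ that act on pairwise disjoint sets of qubits, each set being contained in a pair of neighbouring qubits $\{i,i+1\}$. For a probability measure $\mathcal{E}$ on $\mathbb{U}(d)$ let $\phi^{(2)}_{\mathcal{E}}(X)=\mathbb{E}_{U\sim\mathcal{E}}\big[U^{\otimes 2}X(U^\dagger)^{\otimes 2}\big]$, and let $\phi^{(2)}_{\mathbb{O}(d)}$ be this channel for the normalized Haar measure of $\mathbb{O}(d)$. Let $\|\phi-\psi\|_\diamond=\sup_\rho\|((\phi-\psi)\otimes\mathrm{id}_{\rm anc})(\rho)\|_1$, the supremum being over all finite-dimensional ancillas and all states $\rho$. Let $\mathcal{E}_L$ be any probability measure supported on depth-$L$ circuits and write $\phi_L^{(2)}=\phi^{(2)}_{\mathcal{E}_L}$. Put $$B(d,d_L)=2\left(1-\frac{d_L^2+d_L-2}{(d+2)(d-1)}\right).$$ 1. Let $Z_1$ be the Pauli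 $Z$ operator on the first qubit. If $S$ is a set of qubits such that, for $\mathcal{E}_L$-almost every $U$, $UZ_1U^\dagger$ acts non-trivially only on qubits in $S$, and $d_L=2^{|S|}$ is the dimension of the corresponding space, then $\|\phi_L^{(2)}-\phi_{\mathbb{O}(d)}^{(2)}\|_\diamond\ge B(d,d_L)$. 2. In particular, if $L+1\le n$, then $\|\phi_L^{(2)}-\phi_{\mathbb{O}(d)}^{(2)}\|_\diamond\ge B(d,2^{L+1})$. 3. If $0\le\varepsilon< B(d,d/2)$ and $\mathcal{E}_L$ is an additive $\varepsilon$-approximate $2$-design over $\mathbb{O}(d)$, that is, $\|\phi_L^{(2)}-\phi_{\mathbb{O}(d)}^{(2)}\|_\diamond\le\varepsilon$, then $L\ge n-1$. 4. The threshold in 3, which is the value of the bound in 2 at $L=n-2$, satisfies $B(2^n,2^{n-1})\to 3/2$ as $n\to\infty$. -/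

import Mathlib

open MeasureTheory
open scoped ENNReal NNReal ComplexOrder

noncomputable section

namespace OrthoDesign

/-! ### The unitary group, ensembles and Haar measure -/

section Unitary

variable {ι : Type} [Fintype ι] [DecidableEq ι]

/-- The Borel σ-algebra on the unitary group `𝕌(d)`. -/
instance : MeasurableSpace (Matrix.unitaryGroup ι ℂ) := borel _

instance : BorelSpace (Matrix.unitaryGroup ι ℂ) := ⟨rfl⟩

instance : CompactSpace (Matrix.unitaryGroup ι ℂ) := by
  have hK : IsCompact (Set.pi Set.univ fun _ : ι =>
      Set.pi Set.univ fun _ : ι => Metric.closedBall (0 : ℂ) 1) :=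
    isCompact_univ_pi fun _ => isCompact_univ_pi fun _ => isCompact_closedBall _ _
  have hc : IsClosed {A : Matrix ι ι ℂ | A ∈ Matrix.unitaryGroup ι ℂ} := by
    simp only [Matrix.mem_unitaryGroup_iff]
    exact isClosed_eq (by fun_prop) continuous_const
  refine isCompact_iff_compactSpace.mp (IsCompact.of_isClosed_subset hK hc ?_)
  intro U hU i _ j _
  simpa using entry_norm_bound_of_unitary hU i j

/-- The orthogonal group `𝕆(d) = {U ∈ 𝕌(d) : Uᵀ U = 1}`, as a subgroup of the unitary group. -/
def orthogonal (ι : Type) [Fintype ι] [DecidableEq ι] :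
    Subgroup (Matrix.unitaryGroup ι ℂ) where
  carrier := {U | (U : Matrix ι ι ℂ).transpose * (U : Matrix ι ι ℂ) = 1}
  one_mem' := by simp
  mul_mem' := by
    intro U V hU hV
    simp only [Set.mem_ofPred_eq] at hU hV ⊢
    rw [Submonoid.coe_mul, Matrix.transpose_mul, Matrix.mul_assoc,
      ← Matrix.mul_assoc _ (U : Matrix ι ι ℂ), hU, Matrix.one_mul, hV]
  inv_mem' := by
    intro U hU
    simp only [Set.mem_ofPred_eq] at hU ⊢
    have h1 : ((U⁻¹ : Matrix.unitaryGroup ι ℂ) : Matrix ι ι ℂ) * (U : Matrix ι ι ℂ) = 1 := by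
      rw [← Submonoid.coe_mul, inv_mul_cancel, Submonoid.coe_one]
    have h2 : ((U⁻¹ : Matrix.unitaryGroup ι ℂ) : Matrix ι ι ℂ)
        = (U : Matrix ι ι ℂ).transpose := by
      rw [← Matrix.mul_one ((U⁻¹ : Matrix.unitaryGroup ι ℂ) : Matrix ι ι ℂ),
        ← mul_eq_one_comm.mp hU, ← Matrix.mul_assoc, h1, Matrix.one_mul]
    rw [h2, Matrix.transpose_transpose]
    exact mul_eq_one_comm.mp hU

instance : CompactSpace (orthogonal ι) := by
  refine isCompact_iff_compactSpace.mp (IsClosed.isCompact ?_)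
  change IsClosed {U : Matrix.unitaryGroup ι ℂ |
    (U : Matrix ι ι ℂ).transpose * (U : Matrix ι ι ℂ) = 1}
  exact isClosed_eq (by fun_prop) continuous_const

/-- The Haar ensemble of a compact group `G` of unitaries: the Haar measure of `G` with total mass
`1`, viewed as a measure on the unitary group. -/
def haarEnsemble (G : Subgroup (Matrix.unitaryGroup ι ℂ)) [CompactSpace G] :
    Measure (Matrix.unitaryGroup ι ℂ) :=
  (Measure.haarMeasure (⊤ : TopologicalSpace.PositiveCompacts G)).map Subtype.val

instance (G : Subgroup (Matrix.unitaryGroup ι ℂ)) [CompactSpace G] :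
    IsProbabilityMeasure (haarEnsemble G) := by
  have : IsProbabilityMeasure
      (Measure.haarMeasure (⊤ : TopologicalSpace.PositiveCompacts G)) :=
    ⟨by simpa using Measure.haarMeasure_self (K₀ := (⊤ : TopologicalSpace.PositiveCompacts G))⟩
  exact Measure.isProbabilityMeasure_map measurable_subtype_coe.aemeasurable

/-! ### Moment channels -/

/-- The tensor power `A^{⊗k}`; the computational basis of the `k` copies is indexed
by `Fin k → ι`. -/
def tensorPow (k : ℕ) (A : Matrix ι ι ℂ) : Matrix (Fin k → ι) (Fin k → ι) ℂ :=
  Matrix.of fun x y => ∏ j, A (x j) (y j)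

/-- The map `X ↦ U^{⊗k} X (U†)^{⊗k}`. -/
def twirl (k : ℕ) (U : Matrix.unitaryGroup ι ℂ) (X : Matrix (Fin k → ι) (Fin k → ι) ℂ) :
    Matrix (Fin k → ι) (Fin k → ι) ℂ :=
  tensorPow k (U : Matrix ι ι ℂ) * X * tensorPow k (U : Matrix ι ι ℂ).conjTranspose

lemma integrable_twirl (k : ℕ) (μ : Measure (Matrix.unitaryGroup ι ℂ)) [IsFiniteMeasure μ]
    (X : Matrix (Fin k → ι) (Fin k → ι) ℂ) (a b : Fin k → ι) :
    Integrable (fun U => twirl k U X a b) μ := by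
  have hc : Continuous fun U : Matrix.unitaryGroup ι ℂ => twirl k U X a b := by
    have h : ∀ i j, Continuous fun U : Matrix.unitaryGroup ι ℂ => (U : Matrix ι ι ℂ) i j :=
      fun i j => continuous_subtype_val.matrix_elem i j
    simp only [twirl, tensorPow, Matrix.mul_apply, Matrix.of_apply, Matrix.conjTranspose_apply]
    refine continuous_finsetSum _ fun j _ => Continuous.mul ?_ ?_
    · refine continuous_finsetSum _ fun l _ => Continuous.mul ?_ continuous_const
      exact continuous_finsetProd _ fun _ _ => h _ _
    · exact continuous_finsetProd _ fun _ _ => (h _ _).star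
  exact hc.integrable_of_hasCompactSupport (HasCompactSupport.of_compactSpace _)

/-- The `k`-th moment channel `φ_μ^{(k)}(X) = 𝔼_{U ∼ μ} [U^{⊗k} X (U†)^{⊗k}]` of an
ensemble `μ` (the expectation is taken entrywise). -/
def momentChannel (k : ℕ) (μ : Measure (Matrix.unitaryGroup ι ℂ)) [IsFiniteMeasure μ] :
    Matrix (Fin k → ι) (Fin k → ι) ℂ →ₗ[ℂ] Matrix (Fin k → ι) (Fin k → ι) ℂ where
  toFun X := Matrix.of fun a b => ∫ U, twirl k U X a b ∂μ
  map_add' X Y := by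
    ext a b
    simp only [Matrix.of_apply, Matrix.add_apply]
    rw [← integral_add (integrable_twirl k μ X a b) (integrable_twirl k μ Y a b)]
    simp [twirl, Matrix.mul_add, Matrix.add_mul]
  map_smul' c X := by
    ext a b
    simp only [Matrix.of_apply, Matrix.smul_apply, RingHom.id_apply]
    rw [← integral_smul]
    simp [twirl]

end Unitary

/-! ### Trace norm, diamond distance and designs -/

/-- The trace norm `‖A‖₁ = Tr √(A† A)`, that is, the sum of the singular values of `A`. -/
def traceNorm {κ : Type} [Fintype κ] [DecidableEq κ] (A : Matrix κ κ ℂ) : ℝ :=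
  ∑ i, Real.sqrt ((Matrix.isHermitian_conjTranspose_mul_self A).eigenvalues i)

/-- Quantum states (density matrices). -/
def IsState {κ : Type} [Fintype κ] (ρ : Matrix κ κ ℂ) : Prop :=
  ρ.PosSemidef ∧ ρ.trace = 1

/-- The map `Φ ⊗ id` on operators on `ℋ ⊗ ℋ_anc`: it applies `Φ` to each block
`(1 ⊗ ⟨s|) X (1 ⊗ |t⟩)`. -/
def tensorId {κ : Type} (Φ : Matrix κ κ ℂ →ₗ[ℂ] Matrix κ κ ℂ) (m : ℕ)
    (X : Matrix (κ × Fin m) (κ × Fin m) ℂ) : Matrix (κ × Fin m) (κ × Fin m) ℂ :=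
  Matrix.of fun p q => Φ (Matrix.of fun a b => X (a, p.2) (b, q.2)) p.1 q.1

/-- The diamond distance `‖φ - ψ‖_⋄ = sup_ρ ‖((φ - ψ) ⊗ id)(ρ)‖₁`, the supremum being over all
ancilla dimensions `m` and all states `ρ` on `ℋ ⊗ ℂ^m`. -/
def diamondDist {κ : Type} [Fintype κ] [DecidableEq κ]
    (φ ψ : Matrix κ κ ℂ →ₗ[ℂ] Matrix κ κ ℂ) : ℝ≥0∞ :=
  ⨆ (m : ℕ) (ρ : Matrix (κ × Fin m) (κ × Fin m) ℂ) (_ : IsState ρ),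
    ENNReal.ofReal (traceNorm (tensorId (φ - ψ) m ρ))

/-- The ensemble `μ` is an additive `ε`-approximate `k`-design over the compact group `G`. -/
def IsApproxDesign {ι : Type} [Fintype ι] [DecidableEq ι]
    (G : Subgroup (Matrix.unitaryGroup ι ℂ)) [CompactSpace G] (k : ℕ) (ε : ℝ≥0)
    (μ : Measure (Matrix.unitaryGroup ι ℂ)) [IsFiniteMeasure μ] : Prop :=
  diamondDist (momentChannel k μ) (momentChannel k (haarEnsemble G)) ≤ (ε : ℝ≥0∞)

/-! ### Circuits on a line of qubits -/

/-- The labels of the computational basis of `n` qubits. -/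
abbrev Bits (n : ℕ) : Type := Fin n → Fin 2

/-- `A = B ⊗ 1` with `B` acting on the qubits in `S` and `1` on all other qubits. -/
def SupportedOn {n : ℕ} (S : Finset (Fin n)) (A : Matrix (Bits n) (Bits n) ℂ) : Prop :=
  ∃ B : Matrix (S → Fin 2) (S → Fin 2) ℂ, ∀ x y : Bits n,
    A x y = if ∀ i, i ∉ S → x i = y i then B (fun i => x i) (fun i => y i) else 0

/-- `S` is contained in a pair `{i, i + 1}` of neighbouring qubits of the (open) line. -/
def IsLocal {n : ℕ} (S : Finset (Fin n)) : Prop :=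
  ∃ i : ℕ, ∀ q ∈ S, q.val = i ∨ q.val = i + 1

/-- One time step of a circuit with `2`-local gates from `G`: finitely many gates in `G`, each
acting on (at most) two neighbouring qubits, with pairwise disjoint supports. -/
def IsLayer {n : ℕ} (G : Subgroup (Matrix.unitaryGroup (Bits n) ℂ))
    (W : Matrix.unitaryGroup (Bits n) ℂ) : Prop :=
  ∃ gates : List (Finset (Fin n) × Matrix.unitaryGroup (Bits n) ℂ),
    (∀ g ∈ gates, IsLocal g.1 ∧ g.2 ∈ G ∧ SupportedOn g.1 (g.2 : Matrix (Bits n) (Bits n) ℂ)) ∧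
    gates.Pairwise (fun g h => Disjoint g.1 h.1) ∧
    W = (gates.map Prod.snd).prod

/-- Circuits with `L` time steps of `2`-local gates from `G`. -/
def IsCircuit {n : ℕ} (G : Subgroup (Matrix.unitaryGroup (Bits n) ℂ)) (L : ℕ)
    (U : Matrix.unitaryGroup (Bits n) ℂ) : Prop :=
  ∃ layers : List (Matrix.unitaryGroup (Bits n) ℂ),
    layers.length = L ∧ (∀ W ∈ layers, IsLayer G W) ∧ U = layers.prod

/-- The Pauli operator `Z` on the qubit `q`. -/
def pauliZ {n : ℕ} (q : Fin n) : Matrix (Bits n) (Bits n) ℂ :=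
  Matrix.diagonal fun x => if x q = 0 then 1 else -1

/-- The number `2 (1 - (d_L² + d_L - 2) / ((d + 2)(d - 1)))`. -/
def orthoBound (d dL : ℝ) : ℝ :=
  2 * (1 - (dL ^ 2 + dL - 2) / ((d + 2) * (d - 1)))

end OrthoDesign

end

open OrthoDesign

/-! Let `Z` be the Pauli operator on the first qubit and take as input the two-copy state with
vector `vec Z / √d`, without ancilla. Since `U ⊗ U` sends `vec Z` to `vec (U Z Uᵀ)`, and `Uᵀ = U†`
for orthogonal `U`, the ensemble turns this state into a mixture of the states of `vec (U Z U†)`.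

If every `U Z U†` is supported on `S`, all these vectors lie in the span of the `vec (B ⊗ 1)`, so
its projector `M` has expectation `1`. For the Haar measure, `U Z Uᵀ` spreads evenly over the
traceless symmetric matrices, a space of dimension `(d+2)(d-1)/2`. Those supported on `S` have
dimension `(d_L+2)(d_L-1)/2`, and `M` has as expectation the ratio `t` of the two. The unitary `2M -
1` then separates the two outputs by `1 - (2t - 1) = 2(1 - t)`, which is the bound
(`orthoBound_le_diamondDist`).

The value of `t` comes from the second moments of `U Z Uᵀ` (`conjMoment_eq`). These follow from Haar
invariance under a few explicit reflections, together with `tr (U Z Uᵀ) = 0` and `(U Z Uᵀ)² = 1`; no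
representation theory is needed. For circuits, each layer moves the edge of the support by at most
one qubit (`SupportedOn.conj_layer`), so `S` can be the first `L + 1` qubits. The depth bound
follows because the bound decreases in `d_L`. -/

open OrthoDesign

namespace OrthoDesign

/-! ### Lower bounds on the trace norm and the diamond distance. -/

section TraceNorm

variable {κ : Type} [Fintype κ] [DecidableEq κ]

/-- Duality between the trace norm and the operator norm, for unitary test operators. -/
lemma re_trace_mul_le_traceNorm (W A : Matrix κ κ ℂ) (hW : W * W.conjTranspose = 1) :
    (Matrix.trace (W * A)).re ≤ traceNorm A := by
  set hA := Matrix.isHermitian_conjTranspose_mul_self A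
  set V : Matrix κ κ ℂ := (hA.eigenvectorUnitary : Matrix κ κ ℂ) with hV
  have hV1 : V * V.conjTranspose = 1 :=
    Matrix.mem_unitaryGroup_iff.mp hA.eigenvectorUnitary.2
  have hV2 : V.conjTranspose * V = 1 := mul_eq_one_comm.mp hV1
  -- In the eigenbasis `V` of `A† A`, the columns of `A V` have the singular values as norms and
  -- those of `W† V` are unit vectors. Cauchy–Schwarz, column by column, gives the bound.
  have htr : Matrix.trace (W * A)
      = Matrix.trace ((W.conjTranspose * V).conjTranspose * (A * V)) := by
    rw [Matrix.conjTranspose_mul, Matrix.conjTranspose_conjTranspose, Matrix.mul_assoc,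
      Matrix.trace_mul_comm V.conjTranspose, Matrix.mul_assoc, Matrix.mul_assoc, hV1,
      Matrix.mul_one]
  have hP : (W.conjTranspose * V).conjTranspose * (W.conjTranspose * V) = 1 := by
    rw [Matrix.conjTranspose_mul, Matrix.conjTranspose_conjTranspose, Matrix.mul_assoc,
      ← Matrix.mul_assoc W, hW, Matrix.one_mul, hV2]
  have hQ : (A * V).conjTranspose * (A * V)
      = Matrix.diagonal (fun i => ((hA.eigenvalues i : ℝ) : ℂ)) := by
    have h := hA.conjStarAlgAut_star_eigenvectorUnitary
    rw [Unitary.conjStarAlgAut_star_apply] at h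
    rw [Matrix.conjTranspose_mul]
    simpa [Matrix.star_eq_conjTranspose, Matrix.mul_assoc, Function.comp_def] using h
  rw [htr, traceNorm, Matrix.trace, Complex.re_sum]
  refine Finset.sum_le_sum fun i _ => ?_
  set p : EuclideanSpace ℂ κ := WithLp.toLp 2 fun k => (W.conjTranspose * V) k i
  set q : EuclideanSpace ℂ κ := WithLp.toLp 2 fun k => (A * V) k i
  have hdiag : ∀ B : Matrix κ κ ℂ, (B.conjTranspose * B) i i = ((∑ k, ‖B k i‖ ^ 2 : ℝ) : ℂ) := by
    intro B
    simp only [Matrix.mul_apply, Matrix.conjTranspose_apply, Complex.ofReal_sum,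
      Complex.ofReal_pow, RCLike.star_def, Complex.conj_mul']
  have hp : ‖p‖ = 1 := by
    have h := hdiag (W.conjTranspose * V)
    rw [hP, Matrix.one_apply_eq] at h
    rw [EuclideanSpace.norm_eq]
    have : (∑ k, ‖p k‖ ^ 2 : ℝ) = 1 := by exact_mod_cast h.symm
    rw [this, Real.sqrt_one]
  have hq : ‖q‖ = Real.sqrt (hA.eigenvalues i) := by
    have h := hdiag (A * V)
    rw [hQ, Matrix.diagonal_apply_eq] at h
    rw [EuclideanSpace.norm_eq]
    congr 1
    exact_mod_cast h.symm
  have hin : ((W.conjTranspose * V).conjTranspose * (A * V)) i i = inner ℂ p q := by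
    simp [Matrix.mul_apply, PiLp.inner_apply, p, q, mul_comm]
  rw [Matrix.diag_apply, hin, ← hq]
  calc (inner ℂ p q).re ≤ ‖inner ℂ p q‖ := Complex.re_le_norm _
    _ ≤ ‖p‖ * ‖q‖ := norm_inner_le_norm p q
    _ = ‖q‖ := by rw [hp, one_mul]

/-- A state and a unitary test operator, without ancilla, bound the diamond distance from below. -/
lemma le_diamondDist (φ ψ : Matrix κ κ ℂ →ₗ[ℂ] Matrix κ κ ℂ) (ρ W : Matrix κ κ ℂ)
    (hρ : IsState ρ) (hW : W * W.conjTranspose = 1) {b : ℝ}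
    (hb : (Matrix.trace (W * φ ρ)).re - (Matrix.trace (W * ψ ρ)).re = b) :
    ENNReal.ofReal b ≤ diamondDist φ ψ := by
  let e : κ × Fin 1 ≃ κ := Equiv.prodUnique κ (Fin 1)
  have htrace : ∀ X : Matrix κ κ ℂ, (X.submatrix e e).trace = X.trace := fun X =>
    e.sum_comp fun i => X i i
  have hρ' : IsState (ρ.submatrix e e) := ⟨hρ.1.submatrix e, by rw [htrace, hρ.2]⟩
  have hid : tensorId (φ - ψ) 1 (ρ.submatrix e e) = ((φ - ψ) ρ).submatrix e e := by
    ext p q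
    rfl
  have hW' : W.submatrix e e * (W.submatrix e e).conjTranspose = 1 := by
    rw [Matrix.conjTranspose_submatrix, Matrix.submatrix_mul_equiv, hW,
      Matrix.submatrix_one_equiv]
  refine le_trans (ENNReal.ofReal_le_ofReal ?_)
    (le_iSup_of_le 1 (le_iSup_of_le (ρ.submatrix e e) (le_iSup_of_le hρ' le_rfl)))
  refine le_trans (le_of_eq ?_) (re_trace_mul_le_traceNorm (W.submatrix e e) _ hW')
  rw [hid, Matrix.submatrix_mul_equiv, htrace, LinearMap.sub_apply, Matrix.mul_sub,
    Matrix.trace_sub, Complex.sub_re, hb]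

end TraceNorm

/-! ### Second moments of `U Z Uᵀ` under the Haar measure of the orthogonal group. -/

section HaarMoments

variable {ι : Type} [Fintype ι] [DecidableEq ι]

lemma conjTranspose_eq_transpose_of_mem_orthogonal {U : Matrix.unitaryGroup ι ℂ}
    (hU : U ∈ orthogonal ι) : (U : Matrix ι ι ℂ).conjTranspose = (U : Matrix ι ι ℂ).transpose := by
  have h1 : (U : Matrix ι ι ℂ).transpose * (U : Matrix ι ι ℂ) = 1 := hU
  have h2 : (U : Matrix ι ι ℂ) * (U : Matrix ι ι ℂ).conjTranspose = 1 :=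
    Matrix.mem_unitaryGroup_iff.mp U.2
  rw [← Matrix.one_mul (U : Matrix ι ι ℂ).conjTranspose, ← h1, Matrix.mul_assoc, h2, Matrix.mul_one]

/-- The matrix `1 - t v vᵀ`. -/
noncomputable def reflectionMatrix (v : ι → ℂ) (t : ℝ) : Matrix ι ι ℂ :=
  1 - (t : ℂ) • Matrix.vecMulVec v v

omit [Fintype ι] in
lemma transpose_reflectionMatrix (v : ι → ℂ) (t : ℝ) :
    (reflectionMatrix v t).transpose = reflectionMatrix v t := by
  simp [reflectionMatrix, Matrix.transpose_vecMulVec]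

omit [Fintype ι] in
lemma conjTranspose_reflectionMatrix {v : ι → ℂ} (hv : star v = v) (t : ℝ) :
    (reflectionMatrix v t).conjTranspose = reflectionMatrix v t := by
  simp [reflectionMatrix, Matrix.conjTranspose_vecMulVec, hv]

lemma reflectionMatrix_mul_self {v : ι → ℂ} {t : ℝ} (ht : t * (v ⬝ᵥ v) = 2) :
    reflectionMatrix v t * reflectionMatrix v t = 1 := by
  have h : (t : ℂ) * (t * v ⬝ᵥ v) = t + t := by rw [ht]; ring
  have hP : ((t : ℂ) • Matrix.vecMulVec v v) * ((t : ℂ) • Matrix.vecMulVec v v)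
      = ((t : ℂ) + t) • Matrix.vecMulVec v v := by
    rw [Matrix.smul_mul, Matrix.mul_smul, Matrix.vecMulVec_mul_vecMulVec, Matrix.vecMulVec_smul,
      smul_smul, smul_smul, ← h, mul_assoc]
  simp only [reflectionMatrix, sub_mul, mul_sub, one_mul, mul_one, hP, add_smul]
  abel

/-- The reflection `1 - t v vᵀ` for a real vector `v` with `t (v ⬝ v) = 2`. -/
noncomputable def reflection (v : ι → ℂ) (t : ℝ) (hv : star v = v) (ht : t * (v ⬝ᵥ v) = 2) :
    orthogonal ι :=
  ⟨⟨reflectionMatrix v t, by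
      rw [Matrix.mem_unitaryGroup_iff, Matrix.star_eq_conjTranspose,
        conjTranspose_reflectionMatrix hv, reflectionMatrix_mul_self ht]⟩, by
    change (reflectionMatrix v t).transpose * reflectionMatrix v t = 1
    rw [transpose_reflectionMatrix, reflectionMatrix_mul_self ht]⟩

/-- The Haar expectation of continuous functions on the orthogonal group. -/
noncomputable def haarExpect : C(orthogonal ι, ℂ) →ₗ[ℂ] ℂ where
  toFun f := ∫ g, f g ∂(Measure.haarMeasure (⊤ : TopologicalSpace.PositiveCompacts (orthogonal ι)))
  map_add' f g := integral_add
    (f.continuous.integrable_of_hasCompactSupport (HasCompactSupport.of_compactSpace _))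
    (g.continuous.integrable_of_hasCompactSupport (HasCompactSupport.of_compactSpace _))
  map_smul' c f := integral_smul c f

lemma haarExpect_one : haarExpect (1 : C(orthogonal ι, ℂ)) = 1 := by
  have : IsProbabilityMeasure
      (Measure.haarMeasure (⊤ : TopologicalSpace.PositiveCompacts (orthogonal ι))) :=
    ⟨by simpa using
      Measure.haarMeasure_self (K₀ := (⊤ : TopologicalSpace.PositiveCompacts (orthogonal ι)))⟩
  simp [haarExpect]

lemma haarExpect_eq_of_translate {f g : C(orthogonal ι, ℂ)} (h : orthogonal ι)
    (hfg : ∀ u, f (h * u) = g u) : haarExpect f = haarExpect g := by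
  simp only [haarExpect, LinearMap.coe_mk, AddHom.coe_mk, ← hfg]
  exact (integral_mul_left_eq_self f h).symm

/-- The entries of `U Z Uᵀ`, as functions of the orthogonal matrix `U`. -/
def conjEntry (Z : Matrix ι ι ℂ) (i j : ι) : C(orthogonal ι, ℂ) where
  toFun U := ((U : Matrix.unitaryGroup ι ℂ) * Z *
    ((U : Matrix.unitaryGroup ι ℂ) : Matrix ι ι ℂ).transpose : Matrix ι ι ℂ) i j
  continuous_toFun := by
    have hc : Continuous fun U : orthogonal ι => ((U : Matrix.unitaryGroup ι ℂ) : Matrix ι ι ℂ) :=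
      continuous_subtype_val.comp continuous_subtype_val
    exact ((hc.matrix_mul continuous_const).matrix_mul hc.matrix_transpose).matrix_elem i j

lemma conjEntry_symm {Z : Matrix ι ι ℂ} (hZ : Z.transpose = Z) (i j : ι) :
    conjEntry Z i j = conjEntry Z j i := by
  ext U
  have h : ((U : Matrix.unitaryGroup ι ℂ) * Z *
      ((U : Matrix.unitaryGroup ι ℂ) : Matrix ι ι ℂ).transpose).transpose =
      (U : Matrix.unitaryGroup ι ℂ) * Z *
        ((U : Matrix.unitaryGroup ι ℂ) : Matrix ι ι ℂ).transpose := by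
    simp [Matrix.transpose_mul, hZ, Matrix.mul_assoc]
  exact congrFun (congrFun h j) i

lemma sum_conjEntry_diag (Z : Matrix ι ι ℂ) :
    ∑ i, conjEntry Z i i = Z.trace • (1 : C(orthogonal ι, ℂ)) := by
  ext U
  have h : ((U : Matrix.unitaryGroup ι ℂ) : Matrix ι ι ℂ).transpose *
    ((U : Matrix.unitaryGroup ι ℂ) : Matrix ι ι ℂ) = 1 := U.2
  have : ((U : Matrix.unitaryGroup ι ℂ) * Z *
      ((U : Matrix.unitaryGroup ι ℂ) : Matrix ι ι ℂ).transpose : Matrix ι ι ℂ).trace = Z.trace := by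
    rw [Matrix.mul_assoc, Matrix.trace_mul_comm, Matrix.mul_assoc, h, Matrix.mul_one]
  simpa [conjEntry, ContinuousMap.sum_apply, Matrix.trace] using this

/-- A diagonal entry of `(U Z Uᵀ)² = 1`; symmetry turns it into a sum of squares along a row. This
fixes the scale of the moments. -/
lemma sum_conjEntry_mul_self {Z : Matrix ι ι ℂ} (hZ : Z.transpose = Z) (hZ1 : Z * Z = 1) (i : ι) :
    ∑ j, conjEntry Z i j * conjEntry Z i j = 1 := by
  have hsymm : ∑ j, conjEntry Z i j * conjEntry Z i j = ∑ j, conjEntry Z i j * conjEntry Z j i :=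
    Finset.sum_congr rfl fun j _ => by rw [conjEntry_symm hZ j i]
  rw [hsymm]
  ext U
  have h : ((U : Matrix.unitaryGroup ι ℂ) : Matrix ι ι ℂ).transpose *
    ((U : Matrix.unitaryGroup ι ℂ) : Matrix ι ι ℂ) = 1 := U.2
  have : ((U : Matrix.unitaryGroup ι ℂ) * Z *
      ((U : Matrix.unitaryGroup ι ℂ) : Matrix ι ι ℂ).transpose : Matrix ι ι ℂ) *
      ((U : Matrix.unitaryGroup ι ℂ) * Z *
      ((U : Matrix.unitaryGroup ι ℂ) : Matrix ι ι ℂ).transpose : Matrix ι ι ℂ) = 1 := by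
    simp only [Matrix.mul_assoc]
    rw [← Matrix.mul_assoc _ _ (Z * _), h, Matrix.one_mul, ← Matrix.mul_assoc Z, hZ1,
      Matrix.one_mul, mul_eq_one_comm.mp h]
  have h2 := congrFun (congrFun this i) i
  rw [Matrix.one_apply_eq, Matrix.mul_apply] at h2
  simpa [conjEntry, ContinuousMap.sum_apply] using h2

/-- The second moments of the entries of `U Z Uᵀ`. -/
noncomputable def conjMoment (Z : Matrix ι ι ℂ) (i j k l : ι) : ℂ :=
  haarExpect (conjEntry Z i j * conjEntry Z k l)

/-- The entries of `h U Z Uᵀ h`, where `h = 1 - t v vᵀ`. -/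
noncomputable def reflectedEntry (Z : Matrix ι ι ℂ) (v : ι → ℂ) (t : ℝ) (i j : ι) :
    C(orthogonal ι, ℂ) :=
  conjEntry Z i j - (t * v i) • ∑ m, v m • conjEntry Z m j
    - (t * v j) • ∑ m, v m • conjEntry Z i m
    + (t * v i * (t * v j)) • ∑ m, v m • ∑ n, v n • conjEntry Z m n

/-- Left invariance of the Haar measure under one reflection. Each linear relation between moments
obtained from invariance below is this identity for a suitable `v`. -/
lemma conjMoment_eq_reflected (Z : Matrix ι ι ℂ) (v : ι → ℂ) (t : ℝ) (hv : star v = v)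
    (ht : t * (v ⬝ᵥ v) = 2) (i j k l : ι) :
    conjMoment Z i j k l
      = haarExpect (reflectedEntry Z v t i j * reflectedEntry Z v t k l) := by
  refine haarExpect_eq_of_translate (reflection v t hv ht) fun U => ?_
  have key : ∀ i j, conjEntry Z i j (reflection v t hv ht * U) = reflectedEntry Z v t i j U := by
    intro i j
    set A : Matrix ι ι ℂ := (U : Matrix.unitaryGroup ι ℂ) * Z *
      ((U : Matrix.unitaryGroup ι ℂ) : Matrix ι ι ℂ).transpose with hA
    have h1 : conjEntry Z i j (reflection v t hv ht * U)
        = (reflectionMatrix v t * A * reflectionMatrix v t) i j := by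
      have : conjEntry Z i j (reflection v t hv ht * U)
          = ((reflectionMatrix v t * (U : Matrix.unitaryGroup ι ℂ)) * Z *
            (reflectionMatrix v t * (U : Matrix.unitaryGroup ι ℂ)).transpose : Matrix ι ι ℂ) i j :=
        rfl
      rw [this, Matrix.transpose_mul, transpose_reflectionMatrix]
      simp only [hA, Matrix.mul_assoc]
    have h2 : ∀ i j, conjEntry Z i j U = A i j := fun i j => rfl
    rw [h1]
    simp only [reflectedEntry, ContinuousMap.add_apply, ContinuousMap.sub_apply,
      ContinuousMap.smul_apply, ContinuousMap.sum_apply, h2, smul_eq_mul]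
    have hl : ∀ B : Matrix ι ι ℂ, ∀ i j,
        (reflectionMatrix v t * B) i j = B i j - t * v i * ∑ m, v m * B m j := by
      intro B i j
      simp [reflectionMatrix, sub_mul, Matrix.vecMulVec_mul, Matrix.vecMulVec_apply,
        Matrix.vecMul, dotProduct, mul_assoc]
    have hr : ∀ B : Matrix ι ι ℂ, ∀ i j,
        (B * reflectionMatrix v t) i j = B i j - t * v j * ∑ m, v m * B i m := by
      intro B i j
      simp [reflectionMatrix, mul_sub, Matrix.mul_vecMulVec, Matrix.vecMulVec_apply,
        Matrix.mulVec, dotProduct, mul_comm]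
      ring
    rw [Matrix.mul_assoc, hl, hr]
    simp only [hr, mul_sub, Finset.sum_sub_distrib]
    have : ∑ m, v m * (t * v j * ∑ n, v n * A m n) = t * v j * ∑ m, v m * ∑ n, v n * A m n := by
      rw [Finset.mul_sum]
      exact Finset.sum_congr rfl fun m _ => by ring
    rw [this]
    ring
  rw [ContinuousMap.mul_apply, ContinuousMap.mul_apply, key, key]

/-- The moments vanish if some index occurs an odd number of times. -/
lemma conjMoment_eq_zero (Z : Matrix ι ι ℂ) (p i j k l : ι)
    (h : (if i = p then (-1 : ℂ) else 1) * (if j = p then -1 else 1) * (if k = p then -1 else 1)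
      * (if l = p then -1 else 1) = -1) : conjMoment Z i j k l = 0 := by
  -- This reflection flips the sign of coordinate `p`, so the moment equals its own negative.
  have key := conjMoment_eq_reflected Z (Pi.single p 1) 2 (by simp) (by simp) i j k l
  have hent : ∀ i j, reflectedEntry Z (Pi.single p 1) 2 i j
      = ((if i = p then (-1 : ℂ) else 1) * (if j = p then -1 else 1)) • conjEntry Z i j := by
    intro i j
    simp only [reflectedEntry, Pi.single_apply, ite_smul, one_smul, zero_smul,
      Finset.sum_ite_eq', Finset.mem_univ, if_true]
    by_cases hi : i = p <;> by_cases hj : j = p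
    all_goals
      simp only [hi, hj, if_true, if_false]
      push_cast
      module
  rw [hent, hent, smul_mul_smul_comm, map_smul, ← mul_assoc, h] at key
  change conjMoment Z i j k l = (-1 : ℂ) • conjMoment Z i j k l at key
  rw [neg_one_smul] at key
  exact self_eq_neg.mp key

section Pair

variable {p q : ι}

/-- The reflected entries for `v = a e_p + b e_q`. -/
lemma reflectedEntry_pair (Z : Matrix ι ι ℂ) (a b : ℂ) (t : ℝ) (i j : ι) :
    reflectedEntry Z (Pi.single p a + Pi.single q b) t i j
      = conjEntry Z i j
        - (t * ((if i = p then a else 0) + (if i = q then b else 0))) •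
          (a • conjEntry Z p j + b • conjEntry Z q j)
        - (t * ((if j = p then a else 0) + (if j = q then b else 0))) •
          (a • conjEntry Z i p + b • conjEntry Z i q)
        + (t * ((if i = p then a else 0) + (if i = q then b else 0)) *
            (t * ((if j = p then a else 0) + (if j = q then b else 0)))) •
          (a • (a • conjEntry Z p p + b • conjEntry Z p q)
            + b • (a • conjEntry Z q p + b • conjEntry Z q q)) := by
  simp only [reflectedEntry, Pi.add_apply, Pi.single_apply, add_smul, ite_smul, zero_smul,
    Finset.sum_add_distrib, Finset.sum_ite_eq', Finset.mem_univ, if_true]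

lemma dotProduct_pair (hpq : p ≠ q) (a b : ℂ) :
    (Pi.single p a + Pi.single q b : ι → ℂ) ⬝ᵥ (Pi.single p a + Pi.single q b) = a * a + b * b := by
  simp [hpq, hpq.symm]

/-- The reflection along `e_p - e_q` is the transposition of the two coordinates. -/
lemma conjMoment_diag_swap (Z : Matrix ι ι ℂ) (hpq : p ≠ q) :
    conjMoment Z p p p p = conjMoment Z q q q q := by
  rw [conjMoment_eq_reflected Z (Pi.single p 1 + Pi.single q (-1)) 1
    (by simp) (by rw [dotProduct_pair hpq]; norm_num)]
  have : reflectedEntry Z (Pi.single p 1 + Pi.single q (-1)) 1 p p = conjEntry Z q q := by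
    rw [reflectedEntry_pair Z]
    simp only [hpq, if_true, if_false]
    push_cast
    module
  rw [this, conjMoment]

lemma conjMoment_diag_diag_swap (Z : Matrix ι ι ℂ) (hpq : p ≠ q) {i : ι} (hp : i ≠ p) (hq : i ≠ q) :
    conjMoment Z i i p p = conjMoment Z i i q q := by
  rw [conjMoment_eq_reflected Z (Pi.single p 1 + Pi.single q (-1)) 1
    (by simp) (by rw [dotProduct_pair hpq]; norm_num)]
  have h1 : reflectedEntry Z (Pi.single p 1 + Pi.single q (-1)) 1 p p = conjEntry Z q q := by
    rw [reflectedEntry_pair Z]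
    simp only [hpq, if_true, if_false]
    push_cast
    module
  have h2 : reflectedEntry Z (Pi.single p 1 + Pi.single q (-1)) 1 i i = conjEntry Z i i := by
    rw [reflectedEntry_pair Z]
    simp only [hp, hq, if_false]
    push_cast
    module
  rw [h1, h2, conjMoment]

/-- The relation between the moments that invariance under the reflection `1 - (2 / 5) v vᵀ`,
`v = e_p + 2 e_q`, enforces. -/
lemma conjMoment_offDiag {Z : Matrix ι ι ℂ} (hZ : Z.transpose = Z) (hpq : p ≠ q) :
    2 * conjMoment Z p q p q = conjMoment Z p p p p - conjMoment Z p p q q := by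
  -- On the plane of `e_p, e_q` the reflection is `[[3/5, -4/5], [-4/5, -3/5]]`: it truly mixes the
  -- coordinates, and the 3-4-5 triple keeps all coefficients rational.
  have key := conjMoment_eq_reflected Z (Pi.single p 1 + Pi.single q 2) (2 / 5)
    (by simp) (by rw [dotProduct_pair hpq]; norm_num) p q p q
  have h1 : reflectedEntry Z (Pi.single p 1 + Pi.single q 2) (2 / 5) p q
      = (7 / 25 : ℂ) • conjEntry Z p q + (12 / 25 : ℂ) • conjEntry Z q q
        - (12 / 25 : ℂ) • conjEntry Z p p := by
    rw [reflectedEntry_pair Z, conjEntry_symm hZ q p]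
    simp only [hpq, hpq.symm, if_true, if_false]
    push_cast
    module
  have hexp : ∀ x y z : C(orthogonal ι, ℂ),
      ((7 / 25 : ℂ) • x + (12 / 25 : ℂ) • y - (12 / 25 : ℂ) • z) *
        ((7 / 25 : ℂ) • x + (12 / 25 : ℂ) • y - (12 / 25 : ℂ) • z) =
      (49 / 625 : ℂ) • (x * x) + (144 / 625 : ℂ) • (y * y) + (144 / 625 : ℂ) • (z * z)
        + (168 / 625 : ℂ) • (x * y) - (168 / 625 : ℂ) • (x * z) - (288 / 625 : ℂ) • (z * y) := by
    intro x y z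
    ext u
    simp
    ring
  rw [h1, hexp] at key
  simp only [map_add, map_sub, map_smul, smul_eq_mul] at key
  -- The cross terms containing one off-diagonal factor vanish by parity of the indices.
  have e1 : haarExpect (conjEntry Z p q * conjEntry Z q q) = 0 :=
    conjMoment_eq_zero Z p p q q q (by simp [hpq.symm])
  have e2 : haarExpect (conjEntry Z p q * conjEntry Z p p) = 0 :=
    conjMoment_eq_zero Z q p q p p (by simp [hpq])
  have e3 : haarExpect (conjEntry Z q q * conjEntry Z q q) =
      haarExpect (conjEntry Z p p * conjEntry Z p p) := conjMoment_diag_swap Z hpq.symm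
  rw [e1, e2, e3] at key
  simp only [conjMoment] at key ⊢
  linear_combination (625 / 288 : ℂ) * key

end Pair

variable {Z : Matrix ι ι ℂ}

/-- Expand `E[A_pp tr A] = 0` for `A = U Z Uᵀ`: by the swap symmetry the `d - 1` terms with `k ≠ p`
are equal. -/
lemma conjMoment_diag_diag (htr : Z.trace = 0) {p q : ι} (hpq : p ≠ q) :
    conjMoment Z p p p p + (Fintype.card ι - 1) * conjMoment Z p p q q = 0 := by
  have h0 : ∑ k, conjMoment Z p p k k = 0 := by
    simp only [conjMoment]
    rw [← map_sum, ← Finset.mul_sum, sum_conjEntry_diag, htr, zero_smul, mul_zero, map_zero]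
  rw [← Finset.add_sum_erase _ _ (Finset.mem_univ p), Finset.sum_congr rfl
    (g := fun _ => conjMoment Z p p q q)] at h0
  · rw [Finset.sum_const, Finset.card_erase_of_mem (Finset.mem_univ p), Finset.card_univ,
      nsmul_eq_mul, Nat.cast_sub (Fintype.card_pos_iff.mpr ⟨p⟩), Nat.cast_one] at h0
    exact h0
  · intro k hk
    by_cases hkq : k = q
    · rw [hkq]
    · exact conjMoment_diag_diag_swap Z hkq (Finset.ne_of_mem_erase hk).symm hpq

/-- Expand `E[(A²)_pp] = 1` for `A = U Z Uᵀ` and eliminate the other moments; the two linear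
relations above leave a single unknown. -/
lemma conjMoment_diag [Nontrivial ι] (hZ : Z.transpose = Z) (hZ1 : Z * Z = 1) (htr : Z.trace = 0)
    (p : ι) : (Fintype.card ι + 2) * conjMoment Z p p p p = 2 := by
  have h0 : ∑ k, conjMoment Z p k p k = 1 := by
    simp only [conjMoment]
    rw [← map_sum, sum_conjEntry_mul_self hZ hZ1, haarExpect_one]
  obtain ⟨q, hq⟩ := exists_ne p
  rw [← Finset.add_sum_erase _ _ (Finset.mem_univ p), Finset.sum_congr rfl
    (g := fun _ => (conjMoment Z p p p p - conjMoment Z p p q q) / 2)] at h0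
  · rw [Finset.sum_const, Finset.card_erase_of_mem (Finset.mem_univ p), Finset.card_univ,
      nsmul_eq_mul, Nat.cast_sub (Fintype.card_pos_iff.mpr ⟨p⟩), Nat.cast_one] at h0
    linear_combination 2 * h0 + conjMoment_diag_diag htr hq.symm
  · intro k hk
    have hkp : k ≠ p := Finset.ne_of_mem_erase hk
    have h := conjMoment_offDiag hZ hkp.symm
    have h' : conjMoment Z p p k k = conjMoment Z p p q q := by
      by_cases hkq : k = q
      · rw [hkq]
      · exact conjMoment_diag_diag_swap Z hkq hkp.symm hq.symm
    rw [← h', ← h]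
    ring

/-- The Haar second moments of the entries of `U Z Uᵀ`, for a real symmetric traceless
involution `Z`. -/
lemma conjMoment_eq [Nontrivial ι] (hZ : Z.transpose = Z) (hZ1 : Z * Z = 1) (htr : Z.trace = 0)
    (i j k l : ι) : conjMoment Z i j k l =
      Fintype.card ι / ((Fintype.card ι - 1) * (Fintype.card ι + 2)) *
        ((if i = k then if j = l then 1 else 0 else 0)
          + (if i = l then if j = k then 1 else 0 else 0)
          - 2 / Fintype.card ι * (if i = j then if k = l then 1 else 0 else 0)) := by
  have hd : (1 : ℝ) < Fintype.card ι := by exact_mod_cast Fintype.one_lt_card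
  have hd0 : (Fintype.card ι : ℂ) ≠ 0 := by
    exact_mod_cast (by positivity : (Fintype.card ι : ℝ) ≠ 0)
  have hd1 : (Fintype.card ι - 1 : ℂ) ≠ 0 := by
    exact_mod_cast (by linarith : (0 : ℝ) < Fintype.card ι - 1).ne'
  have hd2 : (Fintype.card ι + 2 : ℂ) ≠ 0 := by
    exact_mod_cast (by linarith : (0 : ℝ) < Fintype.card ι + 2).ne'
  have ha : ∀ p, conjMoment Z p p p p = 2 / (Fintype.card ι + 2) := fun p => by
    rw [eq_div_iff hd2, mul_comm]
    exact conjMoment_diag hZ hZ1 htr p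
  have hb : ∀ p q, p ≠ q → conjMoment Z p p q q
      = -(2 / ((Fintype.card ι - 1) * (Fintype.card ι + 2))) := fun p q hpq => by
    have h := conjMoment_diag_diag htr hpq
    rw [ha] at h
    field_simp at h ⊢
    linear_combination h
  have hc : ∀ p q, p ≠ q → conjMoment Z p q p q
      = Fintype.card ι / ((Fintype.card ι - 1) * (Fintype.card ι + 2)) := fun p q hpq => by
    have h := conjMoment_offDiag hZ hpq
    rw [ha, hb p q hpq] at h
    field_simp at h ⊢
    linear_combination h
  have hc' : ∀ p q, p ≠ q → conjMoment Z p q q p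
      = Fintype.card ι / ((Fintype.card ι - 1) * (Fintype.card ι + 2)) := fun p q hpq => by
    rw [← hc p q hpq, conjMoment, conjMoment, conjEntry_symm hZ q p]
  -- When the four indices do not match in pairs, some index occurs an odd number of times and the
  -- moment vanishes; the paired patterns are `ha`, `hb`, `hc`, `hc'`.
  by_cases hij : i = j
  · subst hij
    by_cases hkl : k = l
    · subst hkl
      by_cases hik : i = k
      · subst hik
        rw [ha]
        simp only [if_true]
        field_simp
        ring
      · rw [hb i k hik]
        simp only [hik, if_true, if_false]
        field_simp
        ring
    · by_cases hik : i = k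
      · subst hik
        rw [conjMoment_eq_zero Z l _ _ _ _ (by simp [hkl])]
        simp [hkl]
      · rw [conjMoment_eq_zero Z k _ _ _ _ (by simp [hik, Ne.symm hkl])]
        simp [hik, hkl]
  · by_cases hik : i = k
    · subst hik
      by_cases hjl : j = l
      · subst hjl
        rw [hc i j hij]
        simp [hij]
      · rw [conjMoment_eq_zero Z j _ _ _ _ (by simp [hij, Ne.symm hjl])]
        simp [hij, hjl, Ne.symm hij]
    · by_cases hil : i = l
      · subst hil
        by_cases hjk : j = k
        · subst hjk
          rw [hc' i j hij]
          simp [hij]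
        · rw [conjMoment_eq_zero Z j _ _ _ _ (by simp [hij, Ne.symm hjk])]
          simp [hij, hjk, hik]
      · rw [conjMoment_eq_zero Z i _ _ _ _ (by simp [Ne.symm hij, Ne.symm hik, Ne.symm hil])]
        simp [hij, hik, hil]

end HaarMoments

/-! ### Supports of operators and the light cone of a circuit. -/

section Support

variable {n : ℕ}

/-- Eliminates the witness `B`, so that supports can be compared entry by entry. -/
lemma supportedOn_iff {S : Finset (Fin n)} {A : Matrix (Bits n) (Bits n) ℂ} :
    SupportedOn S A ↔ (∀ x y, (∃ i ∉ S, x i ≠ y i) → A x y = 0) ∧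
      ∀ x y x' y', (∀ i ∈ S, x i = x' i) → (∀ i ∈ S, y i = y' i) → (∀ i ∉ S, x i = y i) →
        (∀ i ∉ S, x' i = y' i) → A x y = A x' y' := by
  constructor
  · rintro ⟨B, hB⟩
    refine ⟨fun x y ⟨i, hi, hxy⟩ => ?_, fun x y x' y' hx hy h h' => ?_⟩
    · rw [hB, if_neg fun h => hxy (h i hi)]
    · rw [hB, hB, if_pos h, if_pos h']
      congr 1 <;> ext i
      · rw [hx i i.2]
      · rw [hy i i.2]
  · rintro ⟨h0, h1⟩
    -- The bits outside `S` are padded with `0`; any common value would do.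
    let ext : (S → Fin 2) → Bits n := fun s i => if h : i ∈ S then s ⟨i, h⟩ else 0
    refine ⟨Matrix.of fun s t => A (ext s) (ext t), fun x y => ?_⟩
    split_ifs with h
    · refine h1 _ _ _ _ ?_ ?_ h ?_
      · intro i hi; simp [ext, hi]
      · intro i hi; simp [ext, hi]
      · intro i hi; simp [ext, hi]
    · push Not at h
      exact h0 _ _ h

lemma SupportedOn.mono {S T : Finset (Fin n)} {A : Matrix (Bits n) (Bits n) ℂ}
    (hA : SupportedOn S A) (hST : S ⊆ T) : SupportedOn T A := by
  rw [supportedOn_iff] at hA ⊢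
  refine ⟨fun x y ⟨i, hi, hxy⟩ => hA.1 x y ⟨i, fun h => hi (hST h), hxy⟩, ?_⟩
  intro x y x' y' hx hy h h'
  by_cases hc : ∀ i ∉ S, x i = y i
  · refine hA.2 _ _ _ _ (fun i hi => hx i (hST hi)) (fun i hi => hy i (hST hi)) hc ?_
    intro i hi
    by_cases hiT : i ∈ T
    · rw [← hx i hiT, ← hy i hiT, hc i hi]
    · exact h' i hiT
  · push Not at hc
    obtain ⟨i, hi, hne⟩ := hc
    have hiT : i ∈ T := by
      by_contra hiT
      exact hne (h i hiT)
    rw [hA.1 x y ⟨i, hi, hne⟩, hA.1 x' y' ⟨i, hi, by rwa [← hx i hiT, ← hy i hiT]⟩]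

lemma SupportedOn.conjTranspose {S : Finset (Fin n)} {A : Matrix (Bits n) (Bits n) ℂ}
    (hA : SupportedOn S A) : SupportedOn S A.conjTranspose := by
  obtain ⟨B, hB⟩ := hA
  refine ⟨B.conjTranspose, fun x y => ?_⟩
  rw [Matrix.conjTranspose_apply, hB]
  simp only [eq_comm (a := y _)]
  split_ifs <;> simp

/-- The splitting of a bit string into its parts inside and outside `S`. -/
def splitBits (S : Finset (Fin n)) :
    Bits n ≃ (S → Fin 2) × ({i : Fin n // i ∉ S} → Fin 2) :=
  Equiv.piEquivPiSubtypeProd (fun i => i ∈ S) fun _ => Fin 2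

/-- With the labels split as a product, `B ⊗ 1` has the form used for `vecEmbed`. -/
lemma supportedOn_iff_splitBits {S : Finset (Fin n)} {A : Matrix (Bits n) (Bits n) ℂ} :
    SupportedOn S A ↔ ∃ B : Matrix (S → Fin 2) (S → Fin 2) ℂ, ∀ x y,
      A x y = if (splitBits S x).2 = (splitBits S y).2
        then B (splitBits S x).1 (splitBits S y).1 else 0 := by
  refine exists_congr fun B => forall_congr' fun x => forall_congr' fun y => ?_
  have h : (splitBits S x).2 = (splitBits S y).2 ↔ ∀ i, i ∉ S → x i = y i := by
    simp [splitBits, funext_iff, Equiv.piEquivPiSubtypeProd]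
  simp only [h]
  rfl

lemma SupportedOn.mul {S : Finset (Fin n)} {A B : Matrix (Bits n) (Bits n) ℂ}
    (hA : SupportedOn S A) (hB : SupportedOn S B) : SupportedOn S (A * B) := by
  rw [supportedOn_iff_splitBits] at hA hB ⊢
  obtain ⟨A', hA⟩ := hA
  obtain ⟨B', hB⟩ := hB
  refine ⟨A' * B', fun x y => ?_⟩
  simp only [Matrix.mul_apply, hA, hB]
  rw [(splitBits S).sum_comp fun z => (if (splitBits S x).2 = z.2
      then A' (splitBits S x).1 z.1 else 0) *
    (if z.2 = (splitBits S y).2 then B' z.1 (splitBits S y).1 else 0), Fintype.sum_prod_type]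
  by_cases h : (splitBits S x).2 = (splitBits S y).2
  · simp [h]
  · rw [if_neg h]
    refine Finset.sum_eq_zero fun s _ => Finset.sum_eq_zero fun t _ => ?_
    by_cases hx : (splitBits S x).2 = t
    · simp [← hx, h]
    · simp [hx]

lemma SupportedOn.mul_comm_of_disjoint {S T : Finset (Fin n)} {A B : Matrix (Bits n) (Bits n) ℂ}
    (hA : SupportedOn S A) (hB : SupportedOn T B) (hST : Disjoint S T) : A * B = B * A := by
  rw [supportedOn_iff] at hA hB
  rw [Finset.disjoint_left] at hST
  ext x y
  rw [Matrix.mul_apply, Matrix.mul_apply]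
  -- Only one intermediate label can contribute to each product: `z` for `A * B` and `w` for `B *
  -- A`. Each factor preserves the bits outside its own support, and the supports are disjoint.
  let z : Bits n := fun i => if i ∈ S then y i else x i
  let w : Bits n := fun i => if i ∈ S then x i else y i
  rw [Finset.sum_eq_single z, Finset.sum_eq_single w]
  · by_cases hxy : ∀ i, i ∉ S → i ∉ T → x i = y i
    · rw [mul_comm, hA.2 x z w y, hB.2 z y x w]
      all_goals
        intro i hi
        have h1 := hxy i
        have h2 := @hST i
        by_cases hiS : i ∈ S <;> simp_all [z, w]
    · push Not at hxy
      obtain ⟨i, hiS, hiT, hne⟩ := hxy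
      rw [hB.1 z y ⟨i, hiT, by simpa [z, hiS] using hne⟩,
        hB.1 x w ⟨i, hiT, by simpa [w, hiS] using hne⟩, mul_zero, zero_mul]
  · intro u _ hu
    obtain ⟨i, hi⟩ := Function.ne_iff.mp hu
    by_cases hiS : i ∈ S
    · rw [hB.1 x u ⟨i, hST hiS, by simpa [w, hiS, eq_comm] using hi⟩, zero_mul]
    · rw [hA.1 u y ⟨i, hiS, by simpa [w, hiS] using hi⟩, mul_zero]
  · simp
  · intro u _ hu
    obtain ⟨i, hi⟩ := Function.ne_iff.mp hu
    by_cases hiS : i ∈ S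
    · rw [hB.1 u y ⟨i, hST hiS, by simpa [z, hiS] using hi⟩, mul_zero]
    · rw [hA.1 x u ⟨i, hiS, by simpa [z, hiS, eq_comm] using hi⟩, zero_mul]
  · simp

lemma supportedOn_pauliZ (q : Fin n) : SupportedOn {q} (pauliZ q) := by
  rw [supportedOn_iff]
  refine ⟨?_, ?_⟩
  · rintro x y ⟨i, -, hi⟩
    exact Matrix.diagonal_apply_ne _ fun h => hi (congrFun h i)
  · intro x y x' y' hx hy h h'
    have hxq := hx q (Finset.mem_singleton_self q)
    have hyq := hy q (Finset.mem_singleton_self q)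
    have hd : x = y ↔ x' = y' := by
      constructor
      · rintro rfl
        ext i : 1
        by_cases hi : i = q
        · rw [hi, ← hxq, ← hyq]
        · exact h' i (by simpa using hi)
      · rintro rfl
        ext i : 1
        by_cases hi : i = q
        · rw [hi, hxq, hyq]
        · exact h i (by simpa using hi)
    simp only [pauliZ, Matrix.diagonal_apply, hd, hxq]

/-- Conjugation by a gate enlarges the support at most by the support of the gate, and not at all
if the two are disjoint. -/
lemma SupportedOn.conj_gate {S T : Finset (Fin n)} {A : Matrix (Bits n) (Bits n) ℂ}
    {g : Matrix.unitaryGroup (Bits n) ℂ} (hA : SupportedOn S A)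
    (hg : SupportedOn T (g : Matrix (Bits n) (Bits n) ℂ)) :
    SupportedOn (if Disjoint T S then S else T ∪ S)
      ((g : Matrix (Bits n) (Bits n) ℂ) * A * (g : Matrix (Bits n) (Bits n) ℂ).conjTranspose) := by
  split_ifs with h
  · have hu : (g : Matrix (Bits n) (Bits n) ℂ) *
        (g : Matrix (Bits n) (Bits n) ℂ).conjTranspose = 1 :=
      Matrix.mem_unitaryGroup_iff.mp g.2
    rwa [hg.mul_comm_of_disjoint hA h, Matrix.mul_assoc, hu, Matrix.mul_one]
  · exact ((hg.mono Finset.subset_union_left).mul (hA.mono Finset.subset_union_right)).mul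
      (hg.mono Finset.subset_union_left).conjTranspose

/-- Conjugation by a product of gates with pairwise disjoint supports: the support grows only by
the gates that meet it. -/
lemma SupportedOn.conj_gates {S : Finset (Fin n)} {A : Matrix (Bits n) (Bits n) ℂ}
    (hA : SupportedOn S A) :
    ∀ gates : List (Finset (Fin n) × Matrix.unitaryGroup (Bits n) ℂ),
      (∀ g ∈ gates, SupportedOn g.1 (g.2 : Matrix (Bits n) (Bits n) ℂ)) →
      gates.Pairwise (fun g h => Disjoint g.1 h.1) →
      ∃ T : Finset (Fin n), (∀ i ∈ T, i ∈ S ∨ ∃ g ∈ gates, ¬ Disjoint g.1 S ∧ i ∈ g.1) ∧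
        SupportedOn T (((gates.map Prod.snd).prod : Matrix.unitaryGroup (Bits n) ℂ) * A *
          (((gates.map Prod.snd).prod : Matrix.unitaryGroup (Bits n) ℂ) :
            Matrix (Bits n) (Bits n) ℂ).conjTranspose)
  | [], _, _ => ⟨S, fun i hi => Or.inl hi, by simpa using hA⟩
  | g :: gates, hs, hd => by
    rw [List.pairwise_cons] at hd
    obtain ⟨T, hT, hsupp⟩ := SupportedOn.conj_gates hA gates
      (fun h hh => hs h (List.mem_cons_of_mem _ hh)) hd.2
    have key := hsupp.conj_gate (hs g List.mem_cons_self)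
    refine ⟨_, ?_, by
      simpa only [List.map_cons, List.prod_cons, Submonoid.coe_mul, Matrix.conjTranspose_mul,
        Matrix.mul_assoc] using key⟩
    have hT' : ∀ i ∈ T, i ∈ S ∨ ∃ h ∈ g :: gates, ¬ Disjoint h.1 S ∧ i ∈ h.1 := fun i hi =>
      (hT i hi).imp_right fun ⟨h, hh, h'⟩ => ⟨h, List.mem_cons_of_mem _ hh, h'⟩
    intro i hi
    split_ifs at hi with hdisj
    · exact hT' i hi
    · rcases Finset.mem_union.mp hi with hi | hi
      -- If `g` missed `S`, a common point of `g` and `T` would lie in a later gate of the list,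
      -- contradicting disjointness. So `g` meets `S` itself, and chains of gates within one layer
      -- cannot arise.
      · refine Or.inr ⟨g, List.mem_cons_self, fun hgS => hdisj ?_, hi⟩
        rw [Finset.disjoint_left] at hgS ⊢
        intro j hj hjT
        rcases hT j hjT with h | ⟨h, hh, -, hjh⟩
        · exact hgS hj h
        · exact Finset.disjoint_left.mp (hd.1 h hh) hj hjh
      · exact hT' i hi

/-- A layer of gates on neighbouring qubits enlarges an initial segment by at most one qubit. -/
lemma SupportedOn.conj_layer {G : Subgroup (Matrix.unitaryGroup (Bits n) ℂ)} {k : ℕ}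
    {A : Matrix (Bits n) (Bits n) ℂ} (hA : SupportedOn {i : Fin n | i.val ≤ k} A)
    {W : Matrix.unitaryGroup (Bits n) ℂ} (hW : IsLayer G W) :
    SupportedOn {i : Fin n | i.val ≤ k + 1} ((W : Matrix (Bits n) (Bits n) ℂ) * A
      * (W : Matrix (Bits n) (Bits n) ℂ).conjTranspose) := by
  obtain ⟨gates, hg, hd, rfl⟩ := hW
  obtain ⟨T, hT, h⟩ := hA.conj_gates gates (fun g hg' => (hg g hg').2.2) hd
  refine h.mono fun i hi => ?_
  rw [Finset.mem_filter_univ]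
  rcases hT i hi with h | ⟨g, hgm, hmeet, hig⟩
  · rw [Finset.mem_filter_univ] at h
    omega
  · obtain ⟨j, hj, hjk⟩ := Finset.not_disjoint_iff.mp hmeet
    rw [Finset.mem_filter_univ] at hjk
    obtain ⟨m, hm⟩ := (hg g hgm).1
    have h1 := hm i hig
    have h2 := hm j hj
    omega

/-- The light cone of an operator on the first qubit. -/
lemma supportedOn_conj_layers {G : Subgroup (Matrix.unitaryGroup (Bits n) ℂ)}
    {A : Matrix (Bits n) (Bits n) ℂ} (hA : SupportedOn {i : Fin n | i.val ≤ 0} A) :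
    ∀ layers : List (Matrix.unitaryGroup (Bits n) ℂ), (∀ W ∈ layers, IsLayer G W) →
      SupportedOn {i : Fin n | i.val ≤ layers.length}
        ((layers.prod : Matrix.unitaryGroup (Bits n) ℂ) * A *
          ((layers.prod : Matrix.unitaryGroup (Bits n) ℂ) :
            Matrix (Bits n) (Bits n) ℂ).conjTranspose)
  | [], _ => by simpa using hA
  | W :: layers, h => by
    have := (supportedOn_conj_layers hA layers fun V hV =>
      h V (List.mem_cons_of_mem _ hV)).conj_layer (h W List.mem_cons_self)
    simpa only [List.prod_cons, Submonoid.coe_mul, Matrix.conjTranspose_mul,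
        Matrix.mul_assoc, List.length_cons] using this

lemma IsCircuit.supportedOn_conj_pauliZ {G : Subgroup (Matrix.unitaryGroup (Bits n) ℂ)} {L : ℕ}
    {U : Matrix.unitaryGroup (Bits n) ℂ} (hU : IsCircuit G L U) (hn : 0 < n) :
    SupportedOn {i : Fin n | i.val ≤ L} ((U : Matrix (Bits n) (Bits n) ℂ)
      * pauliZ (⟨0, hn⟩ : Fin n) * (U : Matrix (Bits n) (Bits n) ℂ).conjTranspose) := by
  obtain ⟨layers, rfl, hl, rfl⟩ := hU
  refine supportedOn_conj_layers ((supportedOn_pauliZ _).mono ?_) layers hl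
  simp

lemma IsCircuit.mem {G : Subgroup (Matrix.unitaryGroup (Bits n) ℂ)} {L : ℕ}
    {U : Matrix.unitaryGroup (Bits n) ℂ} (hU : IsCircuit G L U) : U ∈ G := by
  obtain ⟨layers, -, hl, rfl⟩ := hU
  refine Subgroup.list_prod_mem _ fun W hW => ?_
  obtain ⟨gates, hg, -, rfl⟩ := hl W hW
  refine Subgroup.list_prod_mem _ fun V hV => ?_
  obtain ⟨g, hgm, rfl⟩ := List.mem_map.mp hV
  exact (hg g hgm).2.1

end Support

/-! ### The projector onto the vectors of operators supported on a tensor factor. -/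

section Projector

open scoped Matrix

variable {ι α β : Type} [Fintype ι] [Fintype α] [Fintype β]
  [DecidableEq ι] [DecidableEq α] [DecidableEq β]

omit [DecidableEq ι] in
lemma sum_finTwo (f : ι → ι → ℂ) : ∑ a : Fin 2 → ι, f (a 0) (a 1) = ∑ i, ∑ j, f i j := by
  rw [← (finTwoArrowEquiv ι).symm.sum_comp, Fintype.sum_prod_type]
  simp [finTwoArrowEquiv]

omit [DecidableEq ι] [DecidableEq α] [DecidableEq β] in
lemma sum_sum_comp (e : ι ≃ α × β) (g : α × β → α × β → ℂ) :
    ∑ i, ∑ j, g (e i) (e j) = ∑ p, ∑ q, g p q := by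
  rw [← e.sum_comp]
  exact Finset.sum_congr rfl fun i _ => e.sum_comp (g (e i))

/-- The map `B ↦ vec (B ⊗ 1)`, for a splitting `e : ι ≃ α × β` of the basis labels. -/
def vecEmbed (e : ι ≃ α × β) : Matrix (Fin 2 → ι) (α × α) ℂ :=
  Matrix.of fun a s => if (e (a 0)).2 = (e (a 1)).2 then
    if (e (a 0)).1 = s.1 then if (e (a 1)).1 = s.2 then 1 else 0 else 0 else 0

omit [Fintype ι] [Fintype α] [Fintype β] [DecidableEq ι] in
lemma conjTranspose_vecEmbed (e : ι ≃ α × β) :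
    (vecEmbed e).conjTranspose = (vecEmbed e).transpose := by
  ext a s
  simp only [Matrix.conjTranspose_apply, Matrix.transpose_apply, vecEmbed, Matrix.of_apply]
  split_ifs <;> simp

-- The vectors `vec (E_st ⊗ 1)` are orthogonal, each of squared norm `|β|`. Hence the normalization
-- of `vecProj`.
omit [DecidableEq ι] in
lemma transpose_vecEmbed_mul (e : ι ≃ α × β) :
    (vecEmbed e).transpose * vecEmbed e = (Fintype.card β : ℂ) • 1 := by
  ext s t
  rw [Matrix.mul_apply]
  simp only [Matrix.transpose_apply, vecEmbed, Matrix.of_apply]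
  have hprod : ∀ p q : α × β, (if p.2 = q.2 then
      if p.1 = s.1 then if q.1 = s.2 then (1 : ℂ) else 0 else 0 else 0) *
      (if p.2 = q.2 then if p.1 = t.1 then if q.1 = t.2 then (1 : ℂ) else 0 else 0 else 0)
      = if p.2 = q.2 then if p.1 = s.1 then if q.1 = s.2 then if s = t then 1 else 0
        else 0 else 0 else 0 := by
    intro p q
    simp only [Prod.ext_iff (x := s)]
    split_ifs <;> simp_all
  simp only [hprod]
  rw [sum_finTwo fun i j => if (e i).2 = (e j).2 then if (e i).1 = s.1 then
      if (e j).1 = s.2 then if s = t then 1 else 0 else 0 else 0 else 0,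
    sum_sum_comp e fun p q => if p.2 = q.2 then if p.1 = s.1 then
      if q.1 = s.2 then if s = t then 1 else 0 else 0 else 0 else 0]
  simp only [Fintype.sum_prod_type]
  change ∑ p : α, ∑ x : β, ∑ q : α, ∑ y : β, (if x = y then if p = s.1 then
    if q = s.2 then if s = t then (1 : ℂ) else 0 else 0 else 0 else 0) = _
  simp [Matrix.one_apply, Finset.sum_ite_irrel]

/-- The projector onto the span of the vectors `vec (B ⊗ 1)`. -/
noncomputable def vecProj (e : ι ≃ α × β) : Matrix (Fin 2 → ι) (Fin 2 → ι) ℂ :=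
  (Fintype.card β : ℂ)⁻¹ • (vecEmbed e * (vecEmbed e).transpose)

omit [DecidableEq ι] in
lemma vecProj_mul_self [Nonempty β] (e : ι ≃ α × β) : vecProj e * vecProj e = vecProj e := by
  have hβ : (Fintype.card β : ℂ) ≠ 0 := by exact_mod_cast Fintype.card_ne_zero
  have h : vecEmbed e * (vecEmbed e).transpose * (vecEmbed e * (vecEmbed e).transpose)
      = (Fintype.card β : ℂ) • (vecEmbed e * (vecEmbed e).transpose) := by
    rw [Matrix.mul_assoc, ← Matrix.mul_assoc _ (vecEmbed e), transpose_vecEmbed_mul,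
      Matrix.smul_mul, Matrix.one_mul, Matrix.mul_smul]
  rw [vecProj, Matrix.smul_mul, Matrix.mul_smul, h,
    smul_smul (Fintype.card β : ℂ)⁻¹ (Fintype.card β : ℂ),
    inv_mul_cancel₀ hβ, one_smul]

omit [Fintype ι] [DecidableEq ι] in
lemma conjTranspose_vecProj (e : ι ≃ α × β) : (vecProj e).conjTranspose = vecProj e := by
  rw [vecProj, Matrix.conjTranspose_smul, Matrix.conjTranspose_mul, ← conjTranspose_vecEmbed,
    Matrix.conjTranspose_conjTranspose, star_inv₀, star_natCast]

omit [DecidableEq ι] in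
lemma vecProj_mulVec [Nonempty β] (e : ι ≃ α × β) {A : Matrix ι ι ℂ} {B : Matrix α α ℂ}
    (hA : ∀ x y, A x y = if (e x).2 = (e y).2 then B (e x).1 (e y).1 else 0) :
    vecProj e *ᵥ (fun a => A (a 0) (a 1)) = fun a => A (a 0) (a 1) := by
  have hβ : (Fintype.card β : ℂ) ≠ 0 := by exact_mod_cast Fintype.card_ne_zero
  have h : (fun a : Fin 2 → ι => A (a 0) (a 1)) = vecEmbed e *ᵥ fun s => B s.1 s.2 := by
    ext a
    simp only [hA, Matrix.mulVec, dotProduct, vecEmbed, Matrix.of_apply, Fintype.sum_prod_type]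
    split_ifs <;> simp
  rw [h, vecProj, Matrix.smul_mulVec, Matrix.mulVec_mulVec, Matrix.mul_assoc,
    transpose_vecEmbed_mul, Matrix.mul_smul, Matrix.mul_one, Matrix.smul_mulVec, smul_smul,
    inv_mul_cancel₀ hβ, one_smul]

omit [Fintype ι] [DecidableEq ι] in
lemma vecProj_apply (e : ι ≃ α × β) (a b : Fin 2 → ι) :
    vecProj e a b = (Fintype.card β : ℂ)⁻¹ * if (e (a 0)).2 = (e (a 1)).2 ∧
      (e (b 0)).2 = (e (b 1)).2 ∧ (e (a 0)).1 = (e (b 0)).1 ∧ (e (a 1)).1 = (e (b 1)).1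
      then 1 else 0 := by
  rw [vecProj, Matrix.smul_apply, smul_eq_mul, Matrix.mul_apply]
  congr 1
  simp only [Matrix.transpose_apply, vecEmbed, Matrix.of_apply, Fintype.sum_prod_type]
  by_cases h1 : (e (a 0)).2 = (e (a 1)).2 <;> by_cases h2 : (e (b 0)).2 = (e (b 1)).2 <;>
    simp [h1, h2, ite_and, eq_comm]

/-- The reflection `2 M - 1` for the projector `M`. -/
lemma two_smul_vecProj_sub_one_unitary [Nonempty β] (e : ι ≃ α × β) :
    ((2 : ℂ) • vecProj e - 1) * ((2 : ℂ) • vecProj e - 1).conjTranspose = 1 := by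
  rw [Matrix.conjTranspose_sub, Matrix.conjTranspose_smul, conjTranspose_vecProj,
    Matrix.conjTranspose_one]
  simp only [star_ofNat, sub_mul, mul_sub, one_mul, mul_one, Matrix.smul_mul, Matrix.mul_smul,
    vecProj_mul_self]
  module

/-- The trace of a projector `vecProj` against the Haar moments. -/
lemma sum_vecProj_mul (e : ι ≃ α × β) [Nonempty β] (r : ℂ) :
    ∑ a : Fin 2 → ι, ∑ b : Fin 2 → ι, vecProj e a b *
      ((if b 0 = a 0 then if b 1 = a 1 then 1 else 0 else 0)
          + (if b 0 = a 1 then if b 1 = a 0 then 1 else 0 else 0)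
          - r * (if b 0 = b 1 then if a 0 = a 1 then 1 else 0 else 0)) =
      (Fintype.card α : ℂ) ^ 2 + Fintype.card α - r * (Fintype.card α * Fintype.card β) := by
  have hβ : (Fintype.card β : ℂ) ≠ 0 := by exact_mod_cast Fintype.card_ne_zero
  simp only [vecProj_apply, mul_assoc, ← Finset.mul_sum]
  rw [inv_mul_eq_iff_eq_mul₀ hβ]
  let m : α × β → α × β → α × β → α × β → ℂ := fun i j k l =>
    if i.2 = j.2 ∧ k.2 = l.2 ∧ i.1 = k.1 ∧ j.1 = l.1 then 1 else 0
  have hsum : ∀ f : ι → ι → ι → ι → ℂ, (∑ a : Fin 2 → ι, ∑ b : Fin 2 → ι,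
      f (a 0) (a 1) (b 0) (b 1)) = ∑ i, ∑ j, ∑ k, ∑ l, f i j k l := by
    intro f
    rw [← sum_finTwo fun i j => ∑ k, ∑ l, f i j k l]
    exact Finset.sum_congr rfl fun a _ => sum_finTwo fun k l => f (a 0) (a 1) k l
  rw [hsum fun i j k l => m (e i) (e j) (e k) (e l) *
    ((if k = i then if l = j then 1 else 0 else 0) + (if k = j then if l = i then 1 else 0 else 0)
      - r * (if k = l then if i = j then 1 else 0 else 0))]
  -- The three pairings give, each multiplied by `|β|`: the trace of the projector, its trace
  -- against the swap, and its expectation in `vec 1`.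
  have h1 : ∑ i, ∑ j, ∑ k, ∑ l, m (e i) (e j) (e k) (e l) *
      (if k = i then if l = j then 1 else 0 else 0) = (Fintype.card α : ℂ) ^ 2 * Fintype.card β := by
    simp only [mul_ite, mul_one, mul_zero, Finset.sum_ite_irrel, Finset.sum_ite_eq',
      Finset.mem_univ, if_true, Finset.sum_const_zero]
    rw [sum_sum_comp e fun p q => m p q p q]
    simp only [m, and_self, and_true, Fintype.sum_prod_type]
    change ∑ p : α, ∑ x : β, ∑ q : α, ∑ y : β, (if x = y then (1 : ℂ) else 0) = _
    simp [-Finset.sum_boole]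
    ring
  have h2 : ∑ i, ∑ j, ∑ k, ∑ l, m (e i) (e j) (e k) (e l) *
      (if k = j then if l = i then 1 else 0 else 0) = (Fintype.card α : ℂ) * Fintype.card β := by
    simp only [mul_ite, mul_one, mul_zero, Finset.sum_ite_irrel, Finset.sum_ite_eq',
      Finset.mem_univ, if_true, Finset.sum_const_zero]
    rw [sum_sum_comp e fun p q => m p q q p]
    simp [m, Fintype.sum_prod_type, ite_and, eq_comm]
  have h3 : ∑ i, ∑ j, ∑ k, ∑ l, m (e i) (e j) (e k) (e l) *
      (if k = l then if i = j then 1 else 0 else 0)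
        = (Fintype.card α : ℂ) * Fintype.card β ^ 2 := by
    simp only [mul_ite, mul_one, mul_zero, Finset.sum_ite_irrel, Finset.sum_ite_eq,
      Finset.mem_univ, if_true, Finset.sum_const_zero]
    rw [sum_sum_comp e fun p q => m p p q q]
    simp only [m, and_self, true_and, Fintype.sum_prod_type]
    change ∑ p : α, ∑ x : β, ∑ q : α, ∑ y : β, (if p = q then (1 : ℂ) else 0) = _
    simp [-Finset.sum_boole]
    exact Or.inl (by ring)
  simp only [mul_sub, mul_add, mul_left_comm _ r, Finset.sum_sub_distrib, Finset.sum_add_distrib,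
    ← Finset.mul_sum, h1, h2, h3]
  ring

end Projector

/-! ### Comparison of the two channels on the state of `vec Z`. -/

section Bound

open scoped Matrix

variable {ι : Type} [Fintype ι] [DecidableEq ι]

/-- The two-copy state with state vector `vec Z / √d`. -/
noncomputable def vecState (Z : Matrix ι ι ℂ) : Matrix (Fin 2 → ι) (Fin 2 → ι) ℂ :=
  (Fintype.card ι : ℂ)⁻¹ • Matrix.vecMulVec (fun a => Z (a 0) (a 1)) (star fun a => Z (a 0) (a 1))

lemma trace_vecState [Nonempty ι] {A : Matrix ι ι ℂ} (hA : A * A.conjTranspose = 1) :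
    (vecState A).trace = 1 := by
  have hd : (Fintype.card ι : ℂ) ≠ 0 := by exact_mod_cast Fintype.card_ne_zero
  have h : ∑ a : Fin 2 → ι, A (a 0) (a 1) * star (A (a 0) (a 1)) = Fintype.card ι := by
    rw [sum_finTwo fun i j => A i j * star (A i j), ← Matrix.trace_one, ← hA]
    simp [Matrix.trace, Matrix.mul_apply]
  rw [vecState, Matrix.trace_smul, smul_eq_mul, Matrix.trace]
  simp only [Matrix.diag_apply, Matrix.vecMulVec_apply, Pi.star_apply, h]
  exact inv_mul_cancel₀ hd

lemma isState_vecState [Nonempty ι] {Z : Matrix ι ι ℂ} (hZ : Z * Z.conjTranspose = 1) :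
    IsState (vecState Z) := by
  refine ⟨(Matrix.posSemidef_vecMulVec_self_star _).smul ?_, trace_vecState hZ⟩
  rw [← Complex.ofReal_natCast, ← Complex.ofReal_inv]
  exact_mod_cast (by positivity : (0 : ℝ) ≤ (Fintype.card ι : ℝ)⁻¹)

omit [DecidableEq ι] in
/-- `U ⊗ U` acts on `vec Z` as `Z ↦ U Z Uᵀ`. -/
lemma tensorPow_two_mulVec (U Z : Matrix ι ι ℂ) :
    tensorPow 2 U *ᵥ (fun a => Z (a 0) (a 1)) = fun a => (U * Z * U.transpose) (a 0) (a 1) := by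
  ext a
  simp only [Matrix.mulVec, dotProduct, tensorPow, Matrix.of_apply, Fin.prod_univ_two]
  rw [sum_finTwo fun i j => U (a 0) i * U (a 1) j * Z i j, Finset.sum_comm]
  simp only [Matrix.mul_apply, Matrix.transpose_apply, Finset.sum_mul]
  exact Finset.sum_congr rfl fun j _ => Finset.sum_congr rfl fun i _ => by ring

lemma twirl_vecState (U : Matrix.unitaryGroup ι ℂ) (Z : Matrix ι ι ℂ) :
    twirl 2 U (vecState Z) = vecState ((U : Matrix ι ι ℂ) * Z * (U : Matrix ι ι ℂ).transpose) := by
  have h : tensorPow 2 (U : Matrix ι ι ℂ).conjTranspose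
      = (tensorPow 2 (U : Matrix ι ι ℂ)).conjTranspose := by
    ext a b
    simp [tensorPow]
  rw [twirl, h, vecState, Matrix.mul_smul, Matrix.smul_mul, Matrix.mul_vecMulVec,
    Matrix.vecMulVec_mul, ← Matrix.star_mulVec, tensorPow_two_mulVec, vecState]

lemma trace_twirl_vecState [Nonempty ι] (U : Matrix.unitaryGroup ι ℂ) {Z : Matrix ι ι ℂ}
    (hZ : Z * Z.conjTranspose = 1) : (twirl 2 U (vecState Z)).trace = 1 := by
  have hU : (U : Matrix ι ι ℂ) * (U : Matrix ι ι ℂ).conjTranspose = 1 :=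
    Matrix.mem_unitaryGroup_iff.mp U.2
  have hU' : (U : Matrix ι ι ℂ).transpose * (U : Matrix ι ι ℂ).transpose.conjTranspose = 1 := by
    have h : (U : Matrix ι ι ℂ).transpose.conjTranspose
        = (U : Matrix ι ι ℂ).conjTranspose.transpose := rfl
    rw [h, ← Matrix.transpose_mul, mul_eq_one_comm.mp hU, Matrix.transpose_one]
  rw [twirl_vecState]
  refine trace_vecState ?_
  simp only [Matrix.conjTranspose_mul, Matrix.mul_assoc]
  rw [← Matrix.mul_assoc (U : Matrix ι ι ℂ).transpose, hU', Matrix.one_mul, ← Matrix.mul_assoc Z,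
    hZ, Matrix.one_mul, hU]

lemma trace_mul_momentChannel (μ : Measure (Matrix.unitaryGroup ι ℂ)) [IsFiniteMeasure μ]
    (W X : Matrix (Fin 2 → ι) (Fin 2 → ι) ℂ) :
    (W * momentChannel 2 μ X).trace = ∫ U, (W * twirl 2 U X).trace ∂μ := by
  simp only [Matrix.trace, Matrix.diag_apply, Matrix.mul_apply]
  rw [integral_finsetSum]
  · refine Finset.sum_congr rfl fun a _ => ?_
    rw [integral_finsetSum]
    · exact Finset.sum_congr rfl fun b _ => (integral_const_mul _ _).symm
    · exact fun b _ => (integrable_twirl 2 μ X b a).const_mul _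
  · exact fun a _ => integrable_finsetSum _ fun b _ => (integrable_twirl 2 μ X b a).const_mul _

lemma map_star_of_mem_orthogonal {U : Matrix.unitaryGroup ι ℂ} (hU : U ∈ orthogonal ι) (i j : ι) :
    star ((U : Matrix ι ι ℂ) i j) = (U : Matrix ι ι ℂ) i j :=
  congrFun (congrFun (conjTranspose_eq_transpose_of_mem_orthogonal hU) j) i

/-- The Haar channel on the state `vec Z`. -/
lemma momentChannel_haar_vecState {Z : Matrix ι ι ℂ} (hreal : ∀ i j, star (Z i j) = Z i j)
    (a b : Fin 2 → ι) :
    momentChannel 2 (haarEnsemble (orthogonal ι)) (vecState Z) a b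
      = (Fintype.card ι : ℂ)⁻¹ * conjMoment Z (a 0) (a 1) (b 0) (b 1) := by
  have hint := (integrable_twirl 2 (haarEnsemble (orthogonal ι)) (vecState Z) a b)
  change ∫ U, twirl 2 U (vecState Z) a b ∂(haarEnsemble (orthogonal ι)) = _
  rw [haarEnsemble, integral_map measurable_subtype_coe.aemeasurable hint.aestronglyMeasurable,
    conjMoment, haarExpect, LinearMap.coe_mk, AddHom.coe_mk, ← integral_const_mul]
  refine integral_congr_ae (Filter.Eventually.of_forall fun U => ?_)
  -- The entries of `U Z Uᵀ` are real, so the conjugate in the outer product drops and `conjMoment`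
  -- remains.
  have hst : ∀ i j, star ((((U : Matrix.unitaryGroup ι ℂ) : Matrix ι ι ℂ) * Z *
      ((U : Matrix.unitaryGroup ι ℂ) : Matrix ι ι ℂ).transpose) i j)
      = (((U : Matrix.unitaryGroup ι ℂ) : Matrix ι ι ℂ) * Z *
      ((U : Matrix.unitaryGroup ι ℂ) : Matrix ι ι ℂ).transpose) i j := by
    intro i j
    simp only [Matrix.mul_apply, Matrix.transpose_apply, star_sum, star_mul', hreal,
      map_star_of_mem_orthogonal U.2]
  change twirl 2 (U : Matrix.unitaryGroup ι ℂ) (vecState Z) a b = _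
  rw [twirl_vecState, vecState, Matrix.smul_apply, smul_eq_mul, Matrix.vecMulVec_apply,
    Pi.star_apply, hst]
  rfl

/-- The lower bound on the diamond distance to the orthogonal moment channel, for an ensemble of
orthogonal matrices that map `Z` to operators on a fixed tensor factor. -/
lemma orthoBound_le_diamondDist {α β : Type} [Fintype α] [Fintype β] [DecidableEq α]
    [DecidableEq β] [Nonempty β] [Nontrivial ι] (e : ι ≃ α × β) {Z : Matrix ι ι ℂ}
    (hreal : ∀ i j, star (Z i j) = Z i j) (hZ : Z.transpose = Z) (hZ1 : Z * Z = 1)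
    (htr : Z.trace = 0) (μ : Measure (Matrix.unitaryGroup ι ℂ)) [IsProbabilityMeasure μ]
    (hμ : ∀ᵐ U ∂μ, U ∈ orthogonal ι) (hsupp : ∀ᵐ (U : Matrix.unitaryGroup ι ℂ) ∂μ,
      ∃ B : Matrix α α ℂ, ∀ x y, ((U : Matrix ι ι ℂ) * Z * (U : Matrix ι ι ℂ).conjTranspose) x y
        = if (e x).2 = (e y).2 then B (e x).1 (e y).1 else 0) :
    ENNReal.ofReal (orthoBound (Fintype.card ι) (Fintype.card α)) ≤
      diamondDist (momentChannel 2 μ) (momentChannel 2 (haarEnsemble (orthogonal ι))) := by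
  have hZct : Z.conjTranspose = Z := by
    ext i j
    rw [Matrix.conjTranspose_apply, hreal, ← Matrix.transpose_apply Z, hZ]
  have hZu : Z * Z.conjTranspose = 1 := by rw [hZct, hZ1]
  refine le_diamondDist _ _ (vecState Z) ((2 : ℂ) • vecProj e - 1) (isState_vecState hZu)
    (two_smul_vecProj_sub_one_unitary e) ?_
  -- Almost every output vector is fixed by the projector, hence by `2M - 1`.
  have h1 : (((2 : ℂ) • vecProj e - 1) * momentChannel 2 μ (vecState Z)).trace = 1 := by
    rw [trace_mul_momentChannel]
    have : ∀ᵐ U ∂μ, (((2 : ℂ) • vecProj e - 1) * twirl 2 U (vecState Z)).trace = 1 := by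
      filter_upwards [hμ, hsupp] with U hU hB
      obtain ⟨B, hB⟩ := hB
      have hP : vecProj e * twirl 2 U (vecState Z) = twirl 2 U (vecState Z) := by
        rw [twirl_vecState, ← conjTranspose_eq_transpose_of_mem_orthogonal hU, vecState,
          Matrix.mul_smul, Matrix.mul_vecMulVec, vecProj_mulVec e hB]
      rw [sub_mul, Matrix.smul_mul, hP, one_mul, two_smul, add_sub_cancel_right,
        trace_twirl_vecState U hZu]
    rw [integral_congr_ae this]
    simp
  have hcard : (Fintype.card ι : ℂ) = Fintype.card α * Fintype.card β := by
    rw [Fintype.card_congr e, Fintype.card_prod, Nat.cast_mul]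
  have hd : (1 : ℝ) < Fintype.card ι := by exact_mod_cast Fintype.one_lt_card
  have hd0 : (Fintype.card ι : ℂ) ≠ 0 := by
    exact_mod_cast (by positivity : (Fintype.card ι : ℝ) ≠ 0)
  have hd1 : (Fintype.card ι - 1 : ℂ) ≠ 0 := by
    exact_mod_cast (by linarith : (0 : ℝ) < Fintype.card ι - 1).ne'
  have hd2 : (Fintype.card ι + 2 : ℂ) ≠ 0 := by
    exact_mod_cast (by linarith : (0 : ℝ) < Fintype.card ι + 2).ne'
  have h2 : (vecProj e * momentChannel 2 (haarEnsemble (orthogonal ι)) (vecState Z)).trace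
      = ((Fintype.card α : ℂ) ^ 2 + Fintype.card α - 2)
        / ((Fintype.card ι + 2) * (Fintype.card ι - 1)) := by
    have h := sum_vecProj_mul e (2 / Fintype.card ι)
    rw [← hcard, div_mul_cancel₀ _ hd0] at h
    rw [← h, Matrix.trace, Finset.sum_div]
    refine Finset.sum_congr rfl fun a _ => ?_
    rw [Matrix.diag_apply, Matrix.mul_apply, Finset.sum_div]
    refine Finset.sum_congr rfl fun b _ => ?_
    rw [momentChannel_haar_vecState hreal, conjMoment_eq hZ hZ1 htr]
    field_simp
  have h3 : (momentChannel 2 (haarEnsemble (orthogonal ι)) (vecState Z)).trace = 1 := by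
    have h := trace_mul_momentChannel (haarEnsemble (orthogonal ι)) 1 (vecState Z)
    rw [one_mul] at h
    rw [h]
    simp [trace_twirl_vecState _ hZu]
  rw [h1, sub_mul, Matrix.smul_mul, one_mul, Matrix.trace_sub, Matrix.trace_smul, h2, h3, orthoBound]
  have hcast : (2 : ℂ) • (((Fintype.card α : ℂ) ^ 2 + Fintype.card α - 2)
        / ((Fintype.card ι + 2) * (Fintype.card ι - 1))) - 1
      = ((2 * (((Fintype.card α : ℝ) ^ 2 + Fintype.card α - 2)
        / ((Fintype.card ι + 2) * (Fintype.card ι - 1))) - 1 : ℝ) : ℂ) := by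
    push_cast
    rw [smul_eq_mul]
  rw [hcast, Complex.ofReal_re, Complex.one_re]
  ring

end Bound

/-! ### The Pauli operator as a real symmetric traceless involution. -/

section PauliZ

variable {n : ℕ} (q : Fin n)

lemma star_pauliZ_apply (x y : Bits n) : star (pauliZ q x y) = pauliZ q x y := by
  simp only [pauliZ, Matrix.diagonal_apply]
  split_ifs <;> simp

lemma transpose_pauliZ : (pauliZ q).transpose = pauliZ q :=
  Matrix.diagonal_transpose _

lemma pauliZ_mul_self : pauliZ q * pauliZ q = 1 := by
  rw [pauliZ, Matrix.diagonal_mul_diagonal, ← Matrix.diagonal_one]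
  congr 1
  ext x
  split_ifs <;> simp

lemma trace_pauliZ : (pauliZ q).trace = 0 := by
  rw [pauliZ, Matrix.trace_diagonal]
  -- Flipping bit `q` pairs opposite signs.
  refine Finset.sum_involution (fun x _ => Function.update x q (1 - x q)) ?_ ?_ ?_ ?_
  · intro x _
    have : x q = 0 ∨ x q = 1 := by omega
    rcases this with h | h <;> simp [h]
  · intro x _ _ h
    have h' := congrFun h q
    rw [Function.update_self] at h'
    omega
  · simp
  · intro x _
    simp

end PauliZ

/-! ### The numerical bound, and its application to circuits. -/

lemma orthoBound_anti {d : ℝ} (hd : 1 < d) {a b : ℝ} (ha : 0 ≤ a) (hab : a ≤ b) :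
    orthoBound d b ≤ orthoBound d a := by
  have h : 0 < (d + 2) * (d - 1) := mul_pos (by linarith) (by linarith)
  unfold orthoBound
  gcongr

lemma tendsto_orthoBound_half :
    Filter.Tendsto (fun n : ℕ => orthoBound (2 ^ n) (2 ^ (n - 1))) Filter.atTop (nhds (3 / 2)) := by
  have h0 : Filter.Tendsto (fun n : ℕ => ((1 : ℝ) / 2) ^ n) Filter.atTop (nhds 0) :=
    tendsto_pow_atTop_nhds_zero_of_lt_one (by norm_num) (by norm_num)
  -- Numerator and denominator are divided by `4 ^ n` and written in `2⁻ⁿ`. The agreement needs `n ≥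
  -- 1`, where `n - 1` is not truncated and `d - 1 ≠ 0`.
  have h1 : Filter.Tendsto (fun n : ℕ => 2 * (1 - (1 / 4 + 1 / 2 * ((1 : ℝ) / 2) ^ n
      - 2 * (((1 : ℝ) / 2) ^ n) ^ 2) / ((1 + 2 * (1 / 2) ^ n) * (1 - (1 / 2) ^ n))))
      Filter.atTop (nhds (2 * (1 - (1 / 4 + 1 / 2 * 0 - 2 * 0 ^ 2) / ((1 + 2 * 0) * (1 - 0))))) := by
    refine ((((h0.const_mul _).const_add _).sub ((h0.pow 2).const_mul _)).div
      (((h0.const_mul _).const_add _).mul (h0.const_sub _)) (by norm_num)).const_sub _ |>.const_mul _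
  refine (h1.congr' ?_).trans (by norm_num)
  filter_upwards [Filter.eventually_ge_atTop 1] with n hn
  obtain ⟨m, rfl⟩ := Nat.exists_eq_add_of_le' hn
  have hm : (1 : ℝ) ≤ 2 ^ m := one_le_pow₀ (by norm_num)
  have hne : (2 : ℝ) ^ m * 2 - 1 ≠ 0 := by linarith
  simp only [orthoBound, Nat.add_sub_cancel, one_div_pow, pow_succ (2 : ℝ) m]
  field_simp
  ring

lemma orthoBound_le_of_supportedOn {n : ℕ} (hn : 0 < n) {L : ℕ}
    (μ : Measure (Matrix.unitaryGroup (Bits n) ℂ)) [IsProbabilityMeasure μ]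
    (hμ : ∀ᵐ U ∂μ, IsCircuit (orthogonal (Bits n)) L U) (S : Finset (Fin n))
    (hS : ∀ᵐ (U : Matrix.unitaryGroup (Bits n) ℂ) ∂μ,
      SupportedOn S ((U : Matrix (Bits n) (Bits n) ℂ) * pauliZ (⟨0, hn⟩ : Fin n)
        * (U : Matrix (Bits n) (Bits n) ℂ).conjTranspose)) :
    ENNReal.ofReal (orthoBound (2 ^ n) (2 ^ S.card)) ≤
      diamondDist (momentChannel 2 μ) (momentChannel 2 (haarEnsemble (orthogonal (Bits n)))) := by
  have : Nonempty (Fin n) := ⟨⟨0, hn⟩⟩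
  have h := orthoBound_le_diamondDist (splitBits S) (star_pauliZ_apply ⟨0, hn⟩)
    (transpose_pauliZ _) (pauliZ_mul_self _) (trace_pauliZ _) μ (hμ.mono fun U hU => hU.mem)
    (hS.mono fun U hU => supportedOn_iff_splitBits.mp hU)
  simpa using h

lemma orthoBound_le_of_depth {n : ℕ} (hn : 0 < n) {L : ℕ}
    (μ : Measure (Matrix.unitaryGroup (Bits n) ℂ)) [IsProbabilityMeasure μ]
    (hμ : ∀ᵐ U ∂μ, IsCircuit (orthogonal (Bits n)) L U) (hL : L + 1 ≤ n) :
    ENNReal.ofReal (orthoBound (2 ^ n) (2 ^ (L + 1))) ≤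
      diamondDist (momentChannel 2 μ) (momentChannel 2 (haarEnsemble (orthogonal (Bits n)))) := by
  have h := orthoBound_le_of_supportedOn hn μ hμ {i : Fin n | i.val ≤ L}
    (hμ.mono fun U hU => hU.supportedOn_conj_pauliZ hn)
  have hcard : Finset.card {i : Fin n | i.val ≤ L} = L + 1 := by
    have := Fin.card_filter_val_lt (n := n) (m := L + 1)
    simp only [Nat.lt_succ_iff] at this
    omega
  rwa [hcard] at h

end OrthoDesign

theorem corollary2 :
    (∀ (n : ℕ) (hn : 0 < n) (L : ℕ) (μ : Measure (Matrix.unitaryGroup (Bits n) ℂ))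
        [IsProbabilityMeasure μ], (∀ᵐ U ∂μ, IsCircuit (orthogonal (Bits n)) L U) →
        -- the bound, for any set `S` of qubits containing the support of all `U Z₁ U†`
        (∀ S : Finset (Fin n),
          (∀ᵐ (U : Matrix.unitaryGroup (Bits n) ℂ) ∂μ,
            SupportedOn S ((U : Matrix (Bits n) (Bits n) ℂ) * pauliZ (⟨0, hn⟩ : Fin n)
              * (U : Matrix (Bits n) (Bits n) ℂ).conjTranspose)) →
          ENNReal.ofReal (orthoBound (2 ^ n) (2 ^ S.card)) ≤
            diamondDist (momentChannel 2 μ)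
              (momentChannel 2 (haarEnsemble (orthogonal (Bits n))))) ∧
        -- the bound with `d_L = 2 ^ (L + 1)`
        (L + 1 ≤ n →
          ENNReal.ofReal (orthoBound (2 ^ n) (2 ^ (L + 1))) ≤
            diamondDist (momentChannel 2 μ)
              (momentChannel 2 (haarEnsemble (orthogonal (Bits n))))) ∧
        -- approximate designs need depth at least `n - 1`
        (∀ ε : ℝ≥0, (ε : ℝ) < orthoBound (2 ^ n) (2 ^ (n - 1)) →
          IsApproxDesign (orthogonal (Bits n)) 2 ε μ → n - 1 ≤ L)) ∧
    -- the value of the bound at `L = n - 2` tends to `3 / 2`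
    Filter.Tendsto (fun n : ℕ => orthoBound (2 ^ n) (2 ^ (n - 1))) Filter.atTop (nhds (3 / 2)) := by
  refine ⟨fun n hn L μ _ hμ => ⟨orthoBound_le_of_supportedOn hn μ hμ,
    orthoBound_le_of_depth hn μ hμ, fun ε hε hdes => ?_⟩, tendsto_orthoBound_half⟩
  by_contra hL
  have hd : (1 : ℝ) < 2 ^ n := one_lt_pow₀ (by norm_num) hn.ne'
  -- If `L < n - 1`, the light cone misses at least one qubit, so `d_L ≤ d / 2` and monotonicity
  -- contradicts the choice of `ε`.
  have hpow : (2 : ℝ) ^ (L + 1) ≤ 2 ^ (n - 1) := pow_le_pow_right₀ (by norm_num) (by omega)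
  have h := (orthoBound_le_of_depth hn μ hμ (by omega)).trans hdes
  rw [← ENNReal.ofReal_coe_nnreal] at h
  linarith [(ENNReal.ofReal_le_ofReal_iff ε.coe_nonneg).mp h,
    orthoBound_anti hd (by positivity) hpow]
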